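/- Let $(X,\mathrm{dist})$ be a metric space whose points are colored with $m$ colors, let $k_1,\dots,k_m\ge 0$ be integers and $k=\sum_i k_i$. For a finite set $S\subseteq X$ let $\mathrm{div}(S)=\sum_{p\in S}\min_{q\in S\setminus\{p\}}\mathrm{dist}(p,q)$ be its sum-of-nearest-neighbor diversity (with value $0$ if $|S|\le 1$), and for a finite $P\subseteq X$ let $\mathrm{div}_{k_1,\dots,k_m}(P)$ be the maximum of $\mathrm{div}(S)$ over all $S\subseteq P$ that contain exactly $k_i$ points of color $i$ for every $i$; $P$ is called feasible if such an $S$ exists. GMM on a finite set $Q$ with $t$ iterations starts with an arbitrary point of $Q$ and in each further iteration adds a point of $Q$ whose distance to the set of points chosen so far is largest, ties being broken arbitrarily (it returns $\emptyset$ if $Q=\emptyset$, and all of $Q$ if $|Q|\le t$). The single-color construction on $Q$ performs $k$ rounds; each round runs GMM with $k+1$ iterations on the current set, stores the returned points and removes them from the current set; the output is the set of all stored points. For a finite $P\subseteq X$ (a part), let $\mathcal A(P)$ be the union of outputs of the single-color construction on the color classes of $P$. Then there are absolute constants $C_1,C_2>0$ such that for all such data, and for all choices made in GMM, the following holds. The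 algorithm always has an output; for every finite $P\subseteq X$ one has $\mathcal A(P)\subseteq P$ and $|\mathcal A(P)|\le C_1\,m\,k^2$; and $\mathcal A$ is a fully composable core-set with approximation factor $O(m\log k)$: for every $N$ and all finite $P^{(1)},\dots,P^{(N)}\subseteq X$ (not necessarily disjoint) whose union is feasible, $\bigcup_j\mathcal A(P^{(j)})$ is feasible and $$\mathrm{div}_{k_1,\dots,k_m}\Big(\bigcup_{j\le N}P^{(j)}\Big)\le C_2\,m\log k\cdot \mathrm{div}_{k_1,\dots,k_m}\Big(\bigcup_{j\le N}\mathcal A(P^{(j)})\Big)$$ (for $k\le 1$ both diversities are $0$, and the factor is read as $0$). -/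

import Mathlib

open Finset

namespace FairDiversity

variable {X : Type*} [MetricSpace X] [DecidableEq X]

/-- The sum-of-nearest-neighbor diversity `∑_{p ∈ S} min_{q ∈ S \ {p}} dist p q`.
`Metric.infDist` to a finite nonempty set is the minimum of the distances. A one-point set has
diversity `0`, because `Metric.infDist` to the empty set is `0`. -/
noncomputable def sumNN (S : Finset X) : ℝ :=
  ∑ p ∈ S, Metric.infDist p (S.erase p : Set X)

/-- The points of color `i` in the point set `P`. -/
def colorClass {m : ℕ} (c : X → Fin m) (P : Finset X) (i : Fin m) : Finset X :=
  P.filter (fun x => c x = i)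

/-- `S ⊆ P` has exactly `κ i` points of each color `i`. -/
def IsFairSelection {m : ℕ} (c : X → Fin m) (κ : Fin m → ℕ) (P S : Finset X) : Prop :=
  S ⊆ P ∧ ∀ i, (colorClass c S i).card = κ i

/-- The optimal fair diversity: the maximum of `sumNN S` over all fair selections `S` from `P`.
It is only meaningful if a fair selection exists (see `fairDiv_isGreatest`). -/
noncomputable def fairDiv {m : ℕ} (c : X → Fin m) (κ : Fin m → ℕ) (P : Finset X) : ℝ :=
  sSup (sumNN '' {S | IsFairSelection c κ P S})

theorem fairDiv_isGreatest {m : ℕ} (c : X → Fin m) (κ : Fin m → ℕ) (P : Finset X)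
    (h : ∃ S, IsFairSelection c κ P S) :
    IsGreatest (sumNN '' {S | IsFairSelection c κ P S}) (fairDiv c κ P) := by
  have hfin : (sumNN '' {S | IsFairSelection c κ P S}).Finite := by
    apply Set.Finite.image
    apply (Finset.finite_toSet P.powerset).subset
    intro S hS
    exact Finset.mem_coe.2 (Finset.mem_powerset.2 hS.1)
  obtain ⟨S, hS⟩ := h
  have hne : (sumNN '' {S | IsFairSelection c κ P S}).Nonempty := ⟨_, S, hS, rfl⟩
  exact ⟨hne.csSup_mem hfin, fun x hx => le_csSup hfin.bddAbove hx⟩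

/-- `GMMOutput P t G`: the set `G` is a possible output of the greedy farthest-point algorithm
GMM on `P` with `t` iterations. The first point is arbitrary; each further iteration
adds a point of `P` that is farthest from the points chosen so far, with ties broken arbitrarily.
On the empty set GMM returns the empty set. Once every point of `P` is chosen, further iterations
change nothing. -/
inductive GMMOutput (P : Finset X) : ℕ → Finset X → Prop
  | empty (t : ℕ) (hP : P = ∅) : GMMOutput P t ∅
  | first (p : X) (hp : p ∈ P) : GMMOutput P 1 {p}
  | step (t : ℕ) (G : Finset X) (p : X) (hG : GMMOutput P t G) (hp : p ∈ P)
      (hmax : ∀ q ∈ P, Metric.infDist q (G : Set X) ≤ Metric.infDist p (G : Set X)) :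
      GMMOutput P (t + 1) (insert p G)

/-- `RoundsOutput t n P S`: the set `S` is a possible result of `n` rounds on `P`, where each round
runs GMM for `t` iterations on the current point set, stores the points that GMM returns, and
removes them from the current point set. -/
inductive RoundsOutput (t : ℕ) : ℕ → Finset X → Finset X → Prop
  | zero (P : Finset X) : RoundsOutput t 0 P ∅
  | succ (n : ℕ) (P G S : Finset X) (hG : GMMOutput P t G) (hS : RoundsOutput t n (P \ G) S) :
      RoundsOutput t (n + 1) P (G ∪ S)

/-- Possible outputs of the single-color core-set construction for sum-of-nearest-neighbor
diversity: `k` rounds of GMM without replacement, each with `k + 1` iterations. -/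
def ColorCoresetOutput (k : ℕ) (P S : Finset X) : Prop :=
  RoundsOutput (k + 1) k P S

/-- Possible outputs on a colored point set: run the single-color construction on every color
class and take the union. -/
def UnionCoresetOutput {m : ℕ} (c : X → Fin m) (k : ℕ) (P T : Finset X) : Prop :=
  ∃ S : Fin m → Finset X,
    (∀ i, ColorCoresetOutput k (colorClass c P i) (S i)) ∧ T = univ.biUnion S

/-- A summarization algorithm (`A P T` means that `T` is a possible output on the part `P`)
constructs an `α`-approximate fully composable core-set: for any finite collection of colored point
sets, each summarized separately, whenever the union of the point sets
admits a fair selection so does the union of the summaries, and its optimal fair diversity is at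
least a `1 / α` fraction of that of the union of the point sets. -/
def IsFullyComposable {m : ℕ} (c : X → Fin m) (κ : Fin m → ℕ)
    (A : Finset X → Finset X → Prop) (α : ℝ) : Prop :=
  ∀ (N : ℕ) (P T : Fin N → Finset X), (∀ j, A (P j) (T j)) →
    (∃ S, IsFairSelection c κ (univ.biUnion P) S) →
      (∃ S, IsFairSelection c κ (univ.biUnion T) S) ∧
        fairDiv c κ (univ.biUnion P) ≤ α * fairDiv c κ (univ.biUnion T)

end FairDiversity

/-!
The construction is used only through a dichotomy that holds at every scale `δ` and for every color:
the summaries contain `k` points of that color at mutual distance at least `δ`, or every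
discarded point of that color has `k` summary points of the same color within distance `δ`.
This dichotomy survives unions of parts.

Let `S` be an optimal fair selection from the union of the parts and fix `δ`. Points whose color is
of the second kind at scale `2 * δ` are kept or moved, injectively, by less than `2 * δ`; points of
the other colors are then moved one at a time to places at distance at least `δ` from all other
points, which is possible because `2 * δ`-separated candidates are more numerous than the points to
be avoided. Hence at least as many points have nearest-neighbor distance at least `δ` in the new
selection as have nearest-neighbor distance at least `5 * δ` in `S`. The number of the latter is
thus at most `D / δ`, where `D` is the optimal fair diversity of the summaries. Such a weak-type
bound at all scales makes the sum of the nearest-neighbor distances in `S` at most `5 * D` times the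
harmonic number of the size of `S`.
-/

namespace FairDiversity

section Reassignment

variable {α β : Type*}

theorem exists_greedy_reassignment {D : β → β → Prop} (hD : ∀ x y, D x y → D y x)
    {C : α → β → Prop} {S A : Finset α} (hAS : A ⊆ S)
    (hC : ∀ p ∈ A, ∀ F : Finset β, F.card < S.card → ∃ y, C p y ∧ ∀ z ∈ F, D y z) (f : α → β) :
    ∃ g : α → β, (∀ p ∉ A, g p = f p) ∧ ∀ p ∈ A, C p (g p) ∧ ∀ q ∈ S, q ≠ p → D (g p) (g q) := by
  classical
  induction A using Finset.induction_on with
  | empty => exact ⟨f, fun _ _ => rfl, by simp⟩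
  | insert a A haA ih =>
    obtain ⟨haS, hA_sub⟩ := insert_subset_iff.1 hAS
    obtain ⟨g, hgf, hgA⟩ := ih hA_sub fun p hp => hC p (mem_insert_of_mem hp)
    -- The new value avoids all other values, also those still to be replaced, so the order in which
    -- `A` is processed does not matter.
    have hcard : ((S.erase a).image g).card < S.card :=
      card_image_le.trans_lt (card_erase_lt_of_mem haS)
    obtain ⟨y, hCy, hDy⟩ := hC a (mem_insert_self a A) _ hcard
    have hyg : ∀ q ∈ S, q ≠ a → D y (g q) := fun q hq hqa =>
      hDy _ (mem_image_of_mem g (mem_erase.2 ⟨hqa, hq⟩))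
    have hne : ∀ p ∈ A, p ≠ a := fun p hp => ne_of_mem_of_not_mem hp haA
    refine ⟨Function.update g a y, fun p hp => ?_, fun p hp => ?_⟩
    · rw [mem_insert, not_or] at hp
      rw [Function.update_of_ne hp.1, hgf p hp.2]
    rcases mem_insert.1 hp with rfl | hpA
    · rw [Function.update_self]
      exact ⟨hCy, fun q hq hqp => by rw [Function.update_of_ne hqp]; exact hyg q hq hqp⟩
    rw [Function.update_of_ne (hne p hpA)]
    refine ⟨(hgA p hpA).1, fun q hq hqp => ?_⟩
    rcases eq_or_ne q a with rfl | hqa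
    · rw [Function.update_self]
      exact hD _ _ (hyg p (hA_sub hpA) hqp.symm)
    · rw [Function.update_of_ne hqa]
      exact (hgA p hpA).2 q hq hqp

theorem exists_injOn_of_self_or_card_le {C : α → α → Prop} {S : Finset α}
    (hC : ∀ p ∈ S, C p p ∨ ∃ Y : Finset α, S.card ≤ Y.card ∧ ∀ y ∈ Y, C p y) :
    ∃ f : α → α, Set.InjOn f S ∧ ∀ p ∈ S, C p (f p) := by
  classical
  have hfresh : ∀ p ∈ S.filter fun p => ¬C p p, ∀ F : Finset α, F.card < S.card →
      ∃ y, C p y ∧ ∀ z ∈ F, y ≠ z := by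
    intro p hp F hF
    obtain ⟨hpS, hpC⟩ := mem_filter.1 hp
    obtain ⟨Y, hcard, hY⟩ := (hC p hpS).resolve_left hpC
    obtain ⟨y, hyY, hyF⟩ := exists_mem_notMem_of_card_lt_card (hF.trans_le hcard)
    exact ⟨y, hY y hyY, fun z hz => (ne_of_mem_of_not_mem hz hyF).symm⟩
  obtain ⟨f, hf_id, hf⟩ :=
    exists_greedy_reassignment (fun _ _ => Ne.symm) (filter_subset _ _) hfresh id
  have hf_self : ∀ p, C p p → f p = p := fun p hp =>
    hf_id p fun h => (mem_filter.1 h).2 hp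
  refine ⟨f, fun p hp q hq hpq => ?_, fun p hp => ?_⟩
  · by_contra hne
    by_cases hpC : C p p
    · by_cases hqC : C q q
      · exact hne (by rwa [hf_self p hpC, hf_self q hqC] at hpq)
      · exact (hf q (mem_filter.2 ⟨hq, hqC⟩)).2 p hp hne hpq.symm
    · exact (hf p (mem_filter.2 ⟨hp, hpC⟩)).2 q hq (Ne.symm hne) hpq
  · by_cases hpC : C p p
    · rwa [hf_self p hpC]
    · exact (hf p (mem_filter.2 ⟨hp, hpC⟩)).1

end Reassignment

theorem sum_le_mul_harmonic_of_mul_card_le {α : Type*} (S : Finset α) (f : α → ℝ) {B : ℝ}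
    (hB : ∀ r, 0 < r → r * ((S.filter fun p => r ≤ f p).card : ℝ) ≤ B) :
    ∑ p ∈ S, f p ≤ B * (harmonic S.card : ℝ) := by
  classical
  induction hn : S.card generalizing S with
  | zero => simp [card_eq_zero.1 hn]
  | succ n ih =>
    obtain ⟨a, ha, hmin⟩ := S.exists_min_image f (card_pos.1 (by omega))
    have hrest : ∑ p ∈ S.erase a, f p ≤ B * (harmonic n : ℝ) := by
      refine ih (S.erase a) (fun r hr => le_trans ?_ (hB r hr)) (by simp [ha, hn])
      gcongr
      exact erase_subset a S
    have hfa : f a * (n + 1) ≤ B := by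
      rcases le_or_gt (f a) 0 with h0 | h0
      · calc f a * (n + 1) ≤ 0 := mul_nonpos_of_nonpos_of_nonneg h0 (by positivity)
          _ ≤ 1 * ((S.filter fun p => 1 ≤ f p).card : ℝ) := by positivity
          _ ≤ B := hB 1 one_pos
      · simpa [filter_true_of_mem hmin, hn] using hB (f a) h0
    calc ∑ p ∈ S, f p = ∑ p ∈ S.erase a, f p + f a := (sum_erase_add S f ha).symm
      _ ≤ B * (harmonic n : ℝ) + B * ((n : ℝ) + 1)⁻¹ :=
        add_le_add hrest ((le_mul_inv_iff₀ (by positivity)).2 hfa)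
      _ = B * (harmonic (n + 1) : ℝ) := by
        rw [harmonic_succ]
        push_cast
        ring

section Colors

variable {X : Type*} {m : ℕ} {c : X → Fin m} {κ : Fin m → ℕ} {P Q S : Finset X}

theorem mem_colorClass {i : Fin m} {x : X} : x ∈ colorClass c P i ↔ x ∈ P ∧ c x = i :=
  mem_filter

theorem colorClass_biUnion [DecidableEq X] {ι : Type*} (J : Finset ι) (P : ι → Finset X)
    (i : Fin m) :
    colorClass c (J.biUnion P) i = J.biUnion fun j => colorClass c (P j) i :=
  filter_biUnion J P _

theorem colorClass_image [DecidableEq X] {g : X → X} (hc : ∀ p ∈ S, c (g p) = c p) (i : Fin m) :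
    colorClass c (S.image g) i = (colorClass c S i).image g := by
  rw [colorClass, filter_image, colorClass]
  congr 1
  exact filter_congr fun p hp => by rw [hc p hp]

theorem card_eq_sum_card_colorClass (c : X → Fin m) (P : Finset X) :
    P.card = ∑ i, (colorClass c P i).card :=
  card_eq_sum_card_fiberwise fun _ _ => mem_coe.2 (mem_univ _)

theorem IsFairSelection.card_eq (h : IsFairSelection c κ P S) : S.card = ∑ i, κ i := by
  rw [card_eq_sum_card_colorClass c S]
  exact sum_congr rfl fun i _ => h.2 i

theorem IsFairSelection.image [DecidableEq X] (h : IsFairSelection c κ P S) {g : X → X}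
    (hg : Set.InjOn g S) (hgQ : ∀ p ∈ S, g p ∈ colorClass c Q (c p)) :
    IsFairSelection c κ Q (S.image g) := by
  refine ⟨image_subset_iff.2 fun p hp => (mem_colorClass.1 (hgQ p hp)).1, fun i => ?_⟩
  rw [colorClass_image fun p hp => (mem_colorClass.1 (hgQ p hp)).2,
    card_image_of_injOn (hg.mono fun p hp => (mem_colorClass.1 hp).1), h.2 i]

end Colors

section MultiscaleCoreset

variable {X : Type*} [PseudoMetricSpace X]

/-- `S` represents `P` at every scale: for each `δ > 0`, either `S` contains `n` points with
pairwise distances at least `δ`, or each point of `P` outside `S` has `n` points of `S` at distance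
less than `δ`. This is the only property of the output of the single-color construction on which
its approximation guarantee depends. -/
def IsMultiscaleCoreset (n : ℕ) (P S : Finset X) : Prop :=
  ∀ δ : ℝ, 0 < δ →
    (∃ G ⊆ S, n ≤ G.card ∧ (G : Set X).Pairwise fun x y => δ ≤ dist x y) ∨
      ∀ p ∈ P, p ∉ S → ∃ Y ⊆ S, n ≤ Y.card ∧ ∀ y ∈ Y, dist p y < δ

theorem IsMultiscaleCoreset.biUnion [DecidableEq X] {ι : Type*} {J : Finset ι}
    {P S : ι → Finset X} {n : ℕ} (h : ∀ j ∈ J, IsMultiscaleCoreset n (P j) (S j)) :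
    IsMultiscaleCoreset n (J.biUnion P) (J.biUnion S) := by
  intro δ hδ
  refine or_iff_not_imp_left.2 fun hsep p hp hpS => ?_
  obtain ⟨j, hj, hpj⟩ := mem_biUnion.1 hp
  have hSj : S j ⊆ J.biUnion S := subset_biUnion_of_mem S hj
  rcases h j hj δ hδ with ⟨G, hG, hGsep⟩ | hclose
  · exact absurd ⟨G, hG.trans hSj, hGsep⟩ hsep
  · obtain ⟨Y, hY, hYclose⟩ := hclose p hpj fun hpSj => hpS (hSj hpSj)
    exact ⟨Y, hY.trans hSj, hYclose⟩

theorem exists_forall_le_dist_of_card_lt {G F : Finset X} {δ : ℝ} (hFG : F.card < G.card)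
    (hG : (G : Set X).Pairwise fun x y => 2 * δ ≤ dist x y) : ∃ y ∈ G, ∀ z ∈ F, δ ≤ dist y z := by
  by_contra! hnear
  choose! φ hφF hφ using hnear
  obtain ⟨x, hx, y, hy, hxy, heq⟩ := exists_ne_map_eq_of_card_lt_of_maps_to hFG hφF
  have hyφ : dist y (φ x) < δ := heq ▸ hφ y hy
  linarith [hG hx hy hxy, hφ x hx, dist_triangle_right x y (φ x)]

theorem exists_injOn_colorClass_dist_lt {m : ℕ} {c : X → Fin m} {U S : Finset X} {δ : ℝ}
    (hδ : 0 < δ)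
    (hS : ∀ p ∈ S, p ∉ U →
      ∃ Y ⊆ colorClass c U (c p), S.card ≤ Y.card ∧ ∀ y ∈ Y, dist p y < δ) :
    ∃ f : X → X, Set.InjOn f S ∧ ∀ p ∈ S, f p ∈ colorClass c U (c p) ∧ dist p (f p) < δ := by
  refine exists_injOn_of_self_or_card_le
    (C := fun p y => y ∈ colorClass c U (c p) ∧ dist p y < δ) fun p hp => ?_
  by_cases hpU : p ∈ U
  · exact .inl ⟨mem_colorClass.2 ⟨hpU, rfl⟩, by rwa [dist_self]⟩
  · obtain ⟨Y, hYU, hcard, hY⟩ := hS p hp hpU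
    exact .inr ⟨Y, hcard, fun y hy => ⟨hYU hy, hY y hy⟩⟩

theorem exists_separated_reassignment {S A : Finset X} (hAS : A ⊆ S) {K : X → Finset X} {δ : ℝ}
    (hK : ∀ p ∈ A, ∃ G ⊆ K p, S.card ≤ G.card ∧
      (G : Set X).Pairwise fun x y => 2 * δ ≤ dist x y) (f : X → X) :
    ∃ g : X → X, (∀ p ∉ A, g p = f p) ∧
      ∀ p ∈ A, g p ∈ K p ∧ ∀ q ∈ S, q ≠ p → δ ≤ dist (g p) (g q) := by
  refine exists_greedy_reassignment (D := fun x y => δ ≤ dist x y) (C := fun p y => y ∈ K p)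
    (fun x y h => dist_comm x y ▸ h) hAS (fun p hp F hF => ?_) f
  obtain ⟨G, hGK, hcard, hG⟩ := hK p hp
  obtain ⟨y, hyG, hy⟩ := exists_forall_le_dist_of_card_lt (hF.trans_le hcard) hG
  exact ⟨y, hGK hyG, hy⟩

theorem exists_injOn_colorClass_le_dist {m : ℕ} {c : X → Fin m} {Q U S : Finset X} (hSQ : S ⊆ Q)
    (hU : ∀ i, IsMultiscaleCoreset S.card (colorClass c Q i) (colorClass c U i))
    {δ : ℝ} (hδ : 0 < δ) :
    ∃ g : X → X, Set.InjOn g S ∧ (∀ p ∈ S, g p ∈ colorClass c U (c p)) ∧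
      ∀ p ∈ S, ∀ q ∈ S, p ≠ q → 5 * δ ≤ dist p q → δ ≤ dist (g p) (g q) := by
  classical
  let Spread (i : Fin m) : Prop := ∃ G ⊆ colorClass c U i, S.card ≤ G.card ∧
    (G : Set X).Pairwise fun x y => 2 * δ ≤ dist x y
  let near := S.filter fun p => ¬Spread (c p)
  let far := S.filter fun p => Spread (c p)
  have hsplit : ∀ p ∈ S, p ∈ near ∨ p ∈ far := fun p hp =>
    (em (Spread (c p))).symm.imp (fun h => mem_filter.2 ⟨hp, h⟩) fun h => mem_filter.2 ⟨hp, h⟩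
  obtain ⟨f, hf_inj, hf⟩ : ∃ f : X → X, Set.InjOn f near ∧
      ∀ p ∈ near, f p ∈ colorClass c U (c p) ∧ dist p (f p) < 2 * δ := by
    refine exists_injOn_colorClass_dist_lt (by positivity) fun p hp hpU => ?_
    obtain ⟨hpS, hp_not_spread⟩ := mem_filter.1 hp
    obtain ⟨Y, hYU, hcard, hY⟩ := (hU (c p) (2 * δ) (by positivity)).resolve_left hp_not_spread p
      (mem_colorClass.2 ⟨hSQ hpS, rfl⟩) fun h => hpU (mem_colorClass.1 h).1
    exact ⟨Y, hYU, (card_filter_le _ _).trans hcard, hY⟩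
  obtain ⟨g, hgf, hg_far⟩ := exists_separated_reassignment (A := far) (filter_subset _ _)
    (fun p hp => (mem_filter.1 hp).2) f
  have hg_near : ∀ p ∈ near, g p = f p := fun p hp =>
    hgf p fun h => (mem_filter.1 hp).2 (mem_filter.1 h).2
  have hcases : ∀ p ∈ S, ∀ q ∈ S, p ≠ q → δ ≤ dist (g p) (g q) ∨ p ∈ near ∧ q ∈ near := by
    intro p hp q hq hpq
    rcases hsplit p hp with hp_near | hp_far
    · rcases hsplit q hq with hq_near | hq_far
      · exact .inr ⟨hp_near, hq_near⟩
      · exact .inl (dist_comm (g p) (g q) ▸ (hg_far q hq_far).2 p hp hpq)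
    · exact .inl ((hg_far p hp_far).2 q hq hpq.symm)
  refine ⟨g, fun p hp q hq heq => ?_, fun p hp => ?_, fun p hp q hq hpq hdist => ?_⟩
  · by_contra hpq
    rcases hcases p hp q hq hpq with hle | ⟨hp_near, hq_near⟩
    · exact hδ.not_ge (by rwa [heq, dist_self] at hle)
    · exact hpq (hf_inj hp_near hq_near (by rwa [← hg_near p hp_near, ← hg_near q hq_near]))
  · exact (hsplit p hp).elim (fun h => hg_near p h ▸ (hf p h).1) fun h => (hg_far p h).1
  · refine (hcases p hp q hq hpq).elim id fun ⟨hp_near, hq_near⟩ => ?_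
    rw [hg_near p hp_near, hg_near q hq_near]
    linarith [(hf p hp_near).2, (hf q hq_near).2, dist_triangle4_right p q (f p) (f q)]

theorem IsFairSelection.exists_of_isMultiscaleCoreset {m : ℕ} {c : X → Fin m} {κ : Fin m → ℕ}
    {Q U S : Finset X} (hS : IsFairSelection c κ Q S)
    (hU : ∀ i, IsMultiscaleCoreset S.card (colorClass c Q i) (colorClass c U i)) :
    ∃ S', IsFairSelection c κ U S' := by
  classical
  obtain ⟨g, hg_inj, hgU, -⟩ := exists_injOn_colorClass_le_dist hS.1 hU one_pos
  exact ⟨S.image g, hS.image hg_inj hgU⟩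

end MultiscaleCoreset

section Diversity

variable {X : Type*} [MetricSpace X] [DecidableEq X]

theorem sumNN_nonneg (S : Finset X) : 0 ≤ sumNN S :=
  sum_nonneg fun _ _ => Metric.infDist_nonneg

theorem sumNN_eq_zero_of_card_le_one {S : Finset X} (hS : S.card ≤ 1) : sumNN S = 0 := by
  refine sum_eq_zero fun p hp => ?_
  have herase : S.erase p = ∅ :=
    (erase_eq_empty_iff S p).2 (.inr (eq_singleton_iff_unique_mem.2
      ⟨hp, fun q hq => card_le_one.1 hS q hq p hp⟩))
  rw [herase, coe_empty, Metric.infDist_empty]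

theorem mul_card_le_sumNN_image {S A : Finset X} {g : X → X} {δ : ℝ} (hS : S.Nontrivial)
    (hAS : A ⊆ S) (hg : Set.InjOn g S)
    (hA : ∀ p ∈ A, ∀ q ∈ S, p ≠ q → δ ≤ dist (g p) (g q)) :
    δ * A.card ≤ sumNN (S.image g) := by
  have hnearest : ∀ p ∈ A, δ ≤ Metric.infDist (g p) ((S.image g).erase (g p) : Set X) := by
    intro p hp
    have hne : ((S.image g).erase (g p)).Nonempty := by
      obtain ⟨q, hq, hqp⟩ := hS.exists_ne p
      exact ⟨g q, mem_erase.2 ⟨hg.ne hq (hAS hp) hqp, mem_image_of_mem g hq⟩⟩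
    refine (Metric.le_infDist (coe_nonempty.2 hne)).2 fun {y} hy => ?_
    obtain ⟨hyp, hyS⟩ := mem_erase.1 (mem_coe.1 hy)
    obtain ⟨q, hq, rfl⟩ := mem_image.1 hyS
    exact hA p hp q hq fun hpq => hyp (congrArg g hpq.symm)
  calc δ * A.card = A.card • δ := by rw [nsmul_eq_mul, mul_comm]
    _ ≤ ∑ p ∈ A, Metric.infDist (g p) ((S.image g).erase (g p) : Set X) :=
      card_nsmul_le_sum A _ δ hnearest
    _ ≤ ∑ p ∈ S, Metric.infDist (g p) ((S.image g).erase (g p) : Set X) :=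
      sum_le_sum_of_subset_of_nonneg hAS fun _ _ _ => Metric.infDist_nonneg
    _ = sumNN (S.image g) := by rw [sumNN, sum_image hg]

variable {m : ℕ} {c : X → Fin m} {κ : Fin m → ℕ} {P Q U S : Finset X}

theorem IsFairSelection.sumNN_le_fairDiv (h : IsFairSelection c κ P S) :
    sumNN S ≤ fairDiv c κ P :=
  (fairDiv_isGreatest c κ P ⟨S, h⟩).2 ⟨S, h, rfl⟩

theorem fairDiv_nonneg (c : X → Fin m) (κ : Fin m → ℕ) (P : Finset X) : 0 ≤ fairDiv c κ P :=
  Real.sSup_nonneg (Set.forall_mem_image.2 fun S _ => sumNN_nonneg S)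

theorem IsFullyComposable.mono {A : Finset X → Finset X → Prop} {a b : ℝ}
    (h : IsFullyComposable c κ A a) (hab : a ≤ b) : IsFullyComposable c κ A b :=
  fun N P T hA hP => (h N P T hA hP).imp_right fun hle =>
    hle.trans (mul_le_mul_of_nonneg_right hab (fairDiv_nonneg c κ _))

theorem IsFairSelection.mul_card_infDist_le_fairDiv (hS : IsFairSelection c κ Q S)
    (hU : ∀ i, IsMultiscaleCoreset S.card (colorClass c Q i) (colorClass c U i))
    (hS_nontrivial : S.Nontrivial) {r : ℝ} (hr : 0 < r) :
    r * ((S.filter fun p => r ≤ Metric.infDist p (S.erase p : Set X)).card : ℝ) ≤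
      5 * fairDiv c κ U := by
  obtain ⟨g, hg_inj, hgU, hg⟩ :=
    exists_injOn_colorClass_le_dist hS.1 hU (δ := r / 5) (by positivity)
  have hsum : r / 5 * ((S.filter fun p => r ≤ Metric.infDist p (S.erase p : Set X)).card : ℝ) ≤
      sumNN (S.image g) := by
    refine mul_card_le_sumNN_image hS_nontrivial (filter_subset _ S) hg_inj
      fun p hp q hq hpq => ?_
    obtain ⟨hpS, hpr⟩ := mem_filter.1 hp
    refine hg p hpS q hq hpq ?_
    calc 5 * (r / 5) = r := by ring
      _ ≤ Metric.infDist p (S.erase p : Set X) := hpr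
      _ ≤ dist p q := Metric.infDist_le_dist_of_mem (mem_coe.2 (mem_erase.2 ⟨hpq.symm, hq⟩))
  linarith [(hS.image hg_inj hgU).sumNN_le_fairDiv]

theorem one_add_log_natCast_le {k : ℕ} (hk : 2 ≤ k) : 1 + Real.log k ≤ 3 * Real.log k := by
  have hlog : Real.log 2 ≤ Real.log k := Real.log_le_log two_pos (by exact_mod_cast hk)
  linarith [Real.log_two_gt_d9]

theorem IsFairSelection.sumNN_le_log_mul_fairDiv (hS : IsFairSelection c κ Q S)
    (hU : ∀ i, IsMultiscaleCoreset S.card (colorClass c Q i) (colorClass c U i)) :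
    sumNN S ≤ 15 * Real.log S.card * fairDiv c κ U := by
  have hU_nonneg := fairDiv_nonneg c κ U
  rcases le_or_gt S.card 1 with hcard | hcard
  · rw [sumNN_eq_zero_of_card_le_one hcard]
    exact mul_nonneg (mul_nonneg (by norm_num) (Real.log_natCast_nonneg _)) hU_nonneg
  calc sumNN S ≤ 5 * fairDiv c κ U * (harmonic S.card : ℝ) :=
        sum_le_mul_harmonic_of_mul_card_le S _ fun _ =>
          hS.mul_card_infDist_le_fairDiv hU (one_lt_card_iff_nontrivial.1 hcard)
    _ ≤ 5 * fairDiv c κ U * (3 * Real.log S.card) := by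
        gcongr
        exact (harmonic_le_one_add_log _).trans (one_add_log_natCast_le hcard)
    _ = 15 * Real.log S.card * fairDiv c κ U := by ring

theorem fairDiv_le_log_mul_fairDiv
    (hU : ∀ i, IsMultiscaleCoreset (∑ i, κ i) (colorClass c Q i) (colorClass c U i))
    (hQ : ∃ S, IsFairSelection c κ Q S) :
    fairDiv c κ Q ≤ 15 * Real.log (∑ i, κ i : ℕ) * fairDiv c κ U := by
  obtain ⟨S, hS, hS_opt⟩ := (fairDiv_isGreatest c κ Q hQ).1
  rw [← hS_opt, ← hS.card_eq]
  exact hS.sumNN_le_log_mul_fairDiv (hS.card_eq ▸ hU)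

end Diversity

section Construction

variable {X : Type*} [MetricSpace X] [DecidableEq X] {P G S T : Finset X} {t n k : ℕ}

theorem GMMOutput.subset (h : GMMOutput P t G) : G ⊆ P := by
  induction h with
  | empty => exact empty_subset _
  | first _ hp => exact singleton_subset_iff.2 hp
  | step _ _ _ _ hp _ ih => exact insert_subset hp ih

theorem GMMOutput.card_le (h : GMMOutput P t G) : G.card ≤ t := by
  induction h with
  | empty => exact zero_le
  | first => exact le_rfl
  | step _ _ _ _ _ _ ih => exact (card_insert_le _ _).trans (Nat.succ_le_succ ih)

/-- The number of iterations is a successor because `GMMOutput P 0 G` forces `P = ∅`. -/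
theorem GMMOutput.exists_output (P : Finset X) (t : ℕ) : ∃ G, GMMOutput P (t + 1) G := by
  rcases P.eq_empty_or_nonempty with hP | hP
  · exact ⟨∅, .empty _ hP⟩
  induction t with
  | zero =>
    obtain ⟨p, hp⟩ := hP
    exact ⟨{p}, .first p hp⟩
  | succ t ih =>
    obtain ⟨G, hG⟩ := ih
    obtain ⟨p, hp, hmax⟩ := P.exists_max_image (fun q => Metric.infDist q (G : Set X)) hP
    exact ⟨insert p G, .step _ G p hG hp hmax⟩

theorem GMMOutput.forall_exists_dist_lt_or_pairwise_le_dist (h : GMMOutput P t G) {δ : ℝ}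
    (hδ : 0 < δ) :
    (∀ q ∈ P, ∃ y ∈ G, dist q y < δ) ∨
      G.card = t ∧ (G : Set X).Pairwise fun x y => δ ≤ dist x y := by
  induction h with
  | empty _ hP => simp [hP]
  | first => simp
  | step t G p _ _ hmax ih =>
    by_cases hcover : ∀ q ∈ P, ∃ y ∈ G, dist q y < δ
    · exact .inl fun q hq => (hcover q hq).imp fun y hy => ⟨mem_insert_of_mem hy.1, hy.2⟩
    obtain ⟨hcard, hsep⟩ := ih.resolve_left hcover
    push Not at hcover
    obtain ⟨q, hq, hq_far⟩ := hcover
    have hp_far : ∀ y ∈ G, δ ≤ dist p y := fun y hy =>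
      calc δ ≤ Metric.infDist q (G : Set X) :=
            (Metric.le_infDist ⟨y, hy⟩).2 fun {z} hz => hq_far z hz
        _ ≤ Metric.infDist p (G : Set X) := hmax q hq
        _ ≤ dist p y := Metric.infDist_le_dist_of_mem hy
    have hpG : p ∉ G := fun hmem => hδ.not_ge (by simpa using hp_far p hmem)
    right
    rw [card_insert_of_notMem hpG, hcard, coe_insert,
      Set.pairwise_insert_of_notMem (mem_coe.not.2 hpG)]
    exact ⟨rfl, hsep, fun y hy => ⟨hp_far y hy, dist_comm p y ▸ hp_far y hy⟩⟩

theorem RoundsOutput.subset (h : RoundsOutput t n P S) : S ⊆ P := by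
  induction h with
  | zero => exact empty_subset _
  | succ _ _ _ _ hG _ ih => exact union_subset hG.subset (ih.trans sdiff_subset)

theorem RoundsOutput.card_le (h : RoundsOutput t n P S) : S.card ≤ n * t := by
  induction h with
  | zero => exact zero_le
  | succ n P G S hG _ ih =>
    calc (G ∪ S).card ≤ G.card + S.card := card_union_le _ _
      _ ≤ t + n * t := Nat.add_le_add hG.card_le ih
      _ = (n + 1) * t := by ring

theorem RoundsOutput.exists_output (t n : ℕ) (P : Finset X) :
    ∃ S, RoundsOutput (t + 1) n P S := by
  induction n generalizing P with
  | zero => exact ⟨∅, .zero P⟩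
  | succ n ih =>
    obtain ⟨G, hG⟩ := GMMOutput.exists_output P t
    obtain ⟨S, hS⟩ := ih (P \ G)
    exact ⟨G ∪ S, .succ n P G S hG hS⟩

/-- If no round returns `t` points at mutual distance at least `δ`, every round covers the points
that it finds. A discarded point is found by every round, and different rounds store different
points. -/
theorem RoundsOutput.exists_separated_or_forall_exists_close (h : RoundsOutput t n P S) {δ : ℝ}
    (hδ : 0 < δ) :
    (∃ G ⊆ S, G.card = t ∧ (G : Set X).Pairwise fun x y => δ ≤ dist x y) ∨
      ∀ p ∈ P, p ∉ S → ∃ Y ⊆ S, Y.card = n ∧ ∀ y ∈ Y, dist p y < δ := by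
  induction h with
  | zero => exact .inr fun p _ _ => ⟨∅, Subset.rfl, rfl, by simp⟩
  | succ n P G S hG hS ih =>
    rcases ih with ⟨H, hH, hsep⟩ | hclose
    · exact .inl ⟨H, hH.trans subset_union_right, hsep⟩
    rcases hG.forall_exists_dist_lt_or_pairwise_le_dist hδ with hcover | hsep
    · refine .inr fun p hp hpGS => ?_
      obtain ⟨hpG, hpS⟩ := not_or.1 (mem_union.not.1 hpGS)
      obtain ⟨Y, hYS, hcard, hY⟩ := hclose p (mem_sdiff.2 ⟨hp, hpG⟩) hpS
      obtain ⟨y, hyG, hy⟩ := hcover p hp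
      have hyY : y ∉ Y := fun hmem => (mem_sdiff.1 (hS.subset (hYS hmem))).2 hyG
      exact ⟨insert y Y, insert_subset (mem_union_left _ hyG) (hYS.trans subset_union_right),
        by rw [card_insert_of_notMem hyY, hcard], (forall_mem_insert _ _ _).2 ⟨hy, hY⟩⟩
    · exact .inl ⟨G, subset_union_left, hsep⟩

theorem ColorCoresetOutput.isMultiscaleCoreset (h : ColorCoresetOutput k P S) {l : ℕ}
    (hl : l ≤ k) : IsMultiscaleCoreset l P S :=
  fun _ hδ => (h.exists_separated_or_forall_exists_close hδ).imp
    (fun ⟨G, hGS, hcard, hG⟩ => ⟨G, hGS, by omega, hG⟩)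
    fun hclose p hp hpS =>
      let ⟨Y, hYS, hcard, hY⟩ := hclose p hp hpS
      ⟨Y, hYS, by omega, hY⟩

variable {m : ℕ} {c : X → Fin m} {κ : Fin m → ℕ}

theorem UnionCoresetOutput.exists_output (c : X → Fin m) (k : ℕ) (P : Finset X) :
    ∃ T, UnionCoresetOutput c k P T := by
  choose S hS using fun i => RoundsOutput.exists_output k k (colorClass c P i)
  exact ⟨_, S, hS, rfl⟩

theorem UnionCoresetOutput.colorCoresetOutput_colorClass (h : UnionCoresetOutput c k P T)
    (i : Fin m) :
    ColorCoresetOutput k (colorClass c P i) (colorClass c T i) := by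
  obtain ⟨S, hS, rfl⟩ := h
  have hSi : colorClass c (univ.biUnion S) i = S i := by
    ext x
    simp only [mem_colorClass, mem_biUnion, mem_univ, true_and]
    refine ⟨fun ⟨⟨j, hxj⟩, hxi⟩ => ?_, fun hx => ⟨⟨i, hx⟩, (mem_colorClass.1 ((hS i).subset hx)).2⟩⟩
    rwa [← hxi, (mem_colorClass.1 ((hS j).subset hxj)).2]
  exact hSi ▸ hS i

theorem UnionCoresetOutput.subset (h : UnionCoresetOutput c k P T) : T ⊆ P := fun x hx =>
  (mem_colorClass.1 ((h.colorCoresetOutput_colorClass (c x)).subset (mem_colorClass.2 ⟨hx, rfl⟩))).1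

theorem UnionCoresetOutput.card_le (h : UnionCoresetOutput c k P T) :
    T.card ≤ m * (k * (k + 1)) := by
  rw [card_eq_sum_card_colorClass c T]
  simpa using sum_le_card_nsmul univ _ _ fun i _ => (h.colorCoresetOutput_colorClass i).card_le

theorem UnionCoresetOutput.card_le_two_mul (h : UnionCoresetOutput c k P T) :
    T.card ≤ 2 * (m * k ^ 2) :=
  calc T.card ≤ m * (k * (k + 1)) := h.card_le
    _ = m * (k ^ 2 + k) := by ring
    _ ≤ m * (k ^ 2 + k ^ 2) := by
        gcongr
        exact Nat.le_self_pow two_ne_zero k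
    _ = 2 * (m * k ^ 2) := by ring

theorem isMultiscaleCoreset_colorClass_biUnion {ι : Type*} {J : Finset ι} {P T : ι → Finset X}
    (hT : ∀ j ∈ J, UnionCoresetOutput c k (P j) (T j)) {l : ℕ} (hl : l ≤ k) (i : Fin m) :
    IsMultiscaleCoreset l (colorClass c (J.biUnion P) i) (colorClass c (J.biUnion T) i) := by
  rw [colorClass_biUnion, colorClass_biUnion]
  exact .biUnion fun j hj => ((hT j hj).colorCoresetOutput_colorClass i).isMultiscaleCoreset hl

theorem isFullyComposable_unionCoresetOutput (c : X → Fin m) (hk : ∑ i, κ i ≤ k) :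
    IsFullyComposable c κ (UnionCoresetOutput c k) (15 * Real.log (∑ i, κ i : ℕ)) := by
  intro N P T hT hP
  have hcoreset := isMultiscaleCoreset_colorClass_biUnion (J := univ) (fun j _ => hT j) hk
  obtain ⟨S, hS⟩ := hP
  exact ⟨hS.exists_of_isMultiscaleCoreset (hS.card_eq ▸ hcoreset),
    fairDiv_le_log_mul_fairDiv hcoreset ⟨S, hS⟩⟩

end Construction

theorem log_sum_le_natCast_mul_log_sum {m : ℕ} (κ : Fin m → ℕ) :
    Real.log (∑ i, κ i : ℕ) ≤ m * Real.log (∑ i, κ i : ℕ) := by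
  rcases m.eq_zero_or_pos with rfl | hm
  · simp
  · exact le_mul_of_one_le_left (Real.log_natCast_nonneg _) (Nat.one_le_cast.2 hm)

end FairDiversity

theorem mainTheorem8_general {X : Type*} [MetricSpace X] [DecidableEq X] {m : ℕ} (c : X → Fin m)
    (κ : Fin m → ℕ) {k : ℕ} (hk : ∑ i, κ i ≤ k) :
    (∀ P : Finset X, ∃ T, FairDiversity.UnionCoresetOutput c k P T) ∧
      (∀ P T : Finset X, FairDiversity.UnionCoresetOutput c k P T →
        T ⊆ P ∧ T.card ≤ 2 * (m * k ^ 2)) ∧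
      FairDiversity.IsFullyComposable c κ (FairDiversity.UnionCoresetOutput c k)
        (15 * Real.log (∑ i, κ i : ℕ)) :=
  ⟨FairDiversity.UnionCoresetOutput.exists_output c k, fun _ _ h => ⟨h.subset, h.card_le_two_mul⟩,
    FairDiversity.isFullyComposable_unionCoresetOutput c hk⟩

theorem mainTheorem8 :
    ∃ C₁ C₂ : ℝ, 0 < C₁ ∧ 0 < C₂ ∧
      ∀ (X : Type*) [MetricSpace X] [DecidableEq X] (m : ℕ) (c : X → Fin m) (κ : Fin m → ℕ)
        (k : ℕ), k = ∑ i, κ i →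
        (∀ P : Finset X, ∃ T, FairDiversity.UnionCoresetOutput c k P T) ∧
        (∀ P T : Finset X, FairDiversity.UnionCoresetOutput c k P T →
          T ⊆ P ∧ (T.card : ℝ) ≤ C₁ * (m * (k : ℝ) ^ 2)) ∧
        FairDiversity.IsFullyComposable c κ (FairDiversity.UnionCoresetOutput c k)
          (C₂ * (m * Real.log k)) := by
  refine ⟨2, 15, two_pos, by norm_num, fun X _ _ m c κ k hk => ?_⟩
  obtain ⟨hexists, hsize, hcomposable⟩ := mainTheorem8_general c κ hk.ge
  refine ⟨hexists, fun P T h => (hsize P T h).imp_right (mod_cast ·), hcomposable.mono ?_⟩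
  exact mul_le_mul_of_nonneg_left
    (hk ▸ FairDiversity.log_sum_le_natCast_mul_log_sum κ) (by norm_num)
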